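/- **Theorem 1 (Morse lemma).** Let $E$ be a geodesic metric space, i.e. any two points $x,y$ of $E$ are joined by a geodesic segment (the image of an isometric embedding of a compact real interval whose endpoints are sent to $x$ and $y$). Let $\delta\ge 0$ and suppose that $E$ is $\delta$-hyperbolic in the sense that every geodesic triangle is $\delta$-thin: for all $x,y,z\in E$ and all geodesic segments $xy$, $xz$, $yz$ joining these points, every point $p\in xy$ satisfies $d(p, xz\cup yz)\le\delta$. Let $\lambda\ge 1$, $c\ge 0$, $l\ge 0$ and let $\gamma:[0,l]\to E$ be a $(\lambda,c)$-quasi-geodesic, i.e. a map, not assumed continuous, such that $$\frac1\lambda|s-t|-c\;\le\; d(\gamma(s),\gamma(t))\;\le\;\lambda|s-t|+c\qquad\text{for all } s,t\in[0,l].$$ Let $\sigma$ be any geodesic segment joining $\gamma(0)$ to $\gamma(l)$. Then $\gamma$ lies in the closed $H$-neighbourhood of $\sigma$, i.e. for every $t\in[0,l]$ there is a point $s\in\sigma$ with $d(\gamma(t),s)\le H$, where $$H=\lambda^2(A_1c+A_2\delta),$$ and $A_1$, $A_2$ are the universal constants $$A_1=312,\qquad A_2=4\left(78+\frac{133}{\ln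 2}\,e^{157\ln 2/28}\right).$$ -/

import Mathlib

open Set

namespace MorseLemma

/-- `S` is a geodesic segment joining `x` to `y`: the image of an isometric embedding
`[0, L] → E` that starts at `x` and ends at `y`. -/
def IsGeodesicSegment {E : Type*} [MetricSpace E] (S : Set E) (x y : E) : Prop :=
  ∃ (L : ℝ) (σ : ℝ → E), 0 ≤ L ∧ σ 0 = x ∧ σ L = y ∧
    (∀ s ∈ Icc (0 : ℝ) L, ∀ t ∈ Icc (0 : ℝ) L, dist (σ s) (σ t) = |s - t|) ∧
    S = σ '' Icc (0 : ℝ) L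

/-- A geodesic metric space: any two points are joined by a geodesic segment. -/
def IsGeodesicSpace (E : Type*) [MetricSpace E] : Prop :=
  ∀ x y : E, ∃ S : Set E, IsGeodesicSegment S x y

/-- `δ`-hyperbolicity of a geodesic metric space: every geodesic triangle is `δ`-thin, that is,
every point of a side is at distance at most `δ` from the union of the two other sides.
(All triangles and all labellings of their vertices are quantified over, so it is enough to
speak about the side `xy`.) -/
def IsHyperbolic (E : Type*) [MetricSpace E] (δ : ℝ) : Prop :=
  ∀ (x y z : E) (XY XZ YZ : Set E),
    IsGeodesicSegment XY x y → IsGeodesicSegment XZ x z → IsGeodesicSegment YZ y z →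
    ∀ p ∈ XY, Metric.infDist p (XZ ∪ YZ) ≤ δ

/-- `f`, restricted to `s`, is a `(lam, c)`-quasi-isometry (no continuity, no coarse
surjectivity). -/
def IsQuasiIsometryOn {X F : Type*} [MetricSpace X] [MetricSpace F]
    (lam c : ℝ) (f : X → F) (s : Set X) : Prop :=
  ∀ x ∈ s, ∀ y ∈ s,
    1 / lam * dist x y - c ≤ dist (f x) (f y) ∧ dist (f x) (f y) ≤ lam * dist x y + c

/-- `γ` is a `(lam, c)`-quasi-geodesic parametrized by the interval `[0, l]`; only the values of
`γ` on `[0, l]` matter. -/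
def IsQuasiGeodesic {F : Type*} [MetricSpace F] (lam c l : ℝ) (γ : ℝ → F) : Prop :=
  0 ≤ l ∧ IsQuasiIsometryOn lam c γ (Icc (0 : ℝ) l)

/-- The constant in front of `c`. -/
def A₁ : ℝ := 312

/-- The constant in front of `δ`. -/
noncomputable def A₂ : ℝ :=
  4 * (78 + 133 / Real.log 2 * Real.exp (157 * Real.log 2 / 28))

end MorseLemma

/-!
The proof compares Gromov products. Let `w` be a point of the quasi-geodesic and sample the
quasi-geodesic with step `δ / lam` (if `δ = 0`, enlarge `δ` and pass to the limit); this gives a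
discrete path `X` in which `k` steps cover a distance at most `k * δ + c` and at least
`k * δ / Λ - c`, with `Λ = lam ^ 2`. Since the distance from `w` to a geodesic `[x, y]` exceeds the
Gromov product `(x | y)` at `w` by at most `2 * δ` (`exists_mem_dist_le_gromovProd`), it suffices to
bound the Gromov product of the endpoints.

The first ingredient is the classical logarithmic estimate: every point of a geodesic joining two
points of the path is within `O(c + δ log Λ)` of the part of the path between them, and within
`c + δ * (a + 1)` if this part has at most `2 ^ a` steps
(`IsDiscreteQuasiGeodesic.exists_dist_le_and_two_pow_le`).

Using this estimate alone would give a bound of the order of `Λ log Λ`. The logarithm is removed by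
an induction over the length of the path (`IsDiscreteQuasiGeodesic.gromovProd_le`). Let `R` be the
Gromov product of the endpoints `X i`, `X j`, and shrink the path to `X i'`, …, `X j'`, where `i'`
and `j'` are such that the products `(X i | X i')` and `(X j | X j')` are about to drop below `R`.
The four point inequality shows `(X i' | X j') ≥ R - 6 * δ`. The geodesics `[X i, X i']` and
`[X j, X j']` both come within about `R` of `w` in the same direction, so that points of them are
close to each other. If these points are at distance about `δ * a` from the path, then
`j' - i'` is at most `Λ * (2 * a + K)` with `K = 5 * c / δ + 20`, while the path has been shortened
by at least `2 ^ a / 2` steps. For the potential `48 * Λ * K * (1 - exp (-k / (Λ * K)))` of a path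
with `k` steps this is a decrease of at least `6` (`exp_neg_mul_two_pow_le`), which pays for the
loss. Here the a priori bound `a = O(log Λ)` is needed, because it keeps `exp (-2 * a / K)` above
`1 / (Λ * K)`. The potential is bounded by `48 * Λ * K`, which is linear in `Λ`.
-/

namespace MorseLemma

/-! ### Geodesic segments -/

section Segments

variable {E : Type*} [MetricSpace E] {S : Set E} {x y p : E}

lemma isGeodesicSegment_image {σ : ℝ → E} {L a b : ℝ}
    (hσ : ∀ s ∈ Icc (0 : ℝ) L, ∀ t ∈ Icc (0 : ℝ) L, dist (σ s) (σ t) = |s - t|)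
    (ha : 0 ≤ a) (hab : a ≤ b) (hb : b ≤ L) :
    IsGeodesicSegment (σ '' Icc a b) (σ a) (σ b) := by
  refine ⟨b - a, fun s => σ (s + a), by linarith, by simp, by simp, ?_, ?_⟩
  · intro s hs t ht
    rw [hσ _ ⟨by linarith [hs.1], by linarith [hs.2]⟩ _ ⟨by linarith [ht.1], by linarith [ht.2]⟩]
    congr 1
    ring
  · ext q
    constructor
    · rintro ⟨s, hs, rfl⟩
      exact ⟨s - a, ⟨by linarith [hs.1], by linarith [hs.2]⟩, by simp⟩
    · rintro ⟨s, hs, rfl⟩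
      exact ⟨s + a, ⟨by linarith [hs.1], by linarith [hs.2]⟩, rfl⟩

namespace IsGeodesicSegment

lemma left_mem (h : IsGeodesicSegment S x y) : x ∈ S := by
  obtain ⟨L, σ, hL, rfl, rfl, -, rfl⟩ := h
  exact ⟨0, ⟨le_rfl, hL⟩, rfl⟩

lemma right_mem (h : IsGeodesicSegment S x y) : y ∈ S := by
  obtain ⟨L, σ, hL, rfl, rfl, -, rfl⟩ := h
  exact ⟨L, ⟨hL, le_rfl⟩, rfl⟩

lemma symm (h : IsGeodesicSegment S x y) : IsGeodesicSegment S y x := by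
  obtain ⟨L, σ, hL, rfl, rfl, hσ, rfl⟩ := h
  refine ⟨L, fun s => σ (L - s), hL, by simp, by simp, ?_, ?_⟩
  · intro s hs t ht
    rw [hσ _ ⟨by linarith [hs.2], by linarith [hs.1]⟩ _ ⟨by linarith [ht.2], by linarith [ht.1]⟩,
      abs_sub_comm]
    congr 1
    ring
  · ext q
    constructor
    · rintro ⟨s, hs, rfl⟩
      exact ⟨L - s, ⟨by linarith [hs.2], by linarith [hs.1]⟩, by simp⟩
    · rintro ⟨s, hs, rfl⟩
      exact ⟨L - s, ⟨by linarith [hs.2], by linarith [hs.1]⟩, rfl⟩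

lemma isCompact_and_isPreconnected (h : IsGeodesicSegment S x y) :
    IsCompact S ∧ IsPreconnected S := by
  obtain ⟨L, σ, hL, rfl, rfl, hσ, rfl⟩ := h
  have hc : ContinuousOn σ (Icc 0 L) := by
    rw [Metric.continuousOn_iff]
    intro b hb ε hε
    refine ⟨ε, hε, fun a ha hab => ?_⟩
    rw [hσ a ha b hb]
    rwa [Real.dist_eq] at hab
  exact ⟨isCompact_Icc.image_of_continuousOn hc, isPreconnected_Icc.image σ hc⟩

lemma isCompact (h : IsGeodesicSegment S x y) : IsCompact S :=
  h.isCompact_and_isPreconnected.1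

lemma isPreconnected (h : IsGeodesicSegment S x y) : IsPreconnected S :=
  h.isCompact_and_isPreconnected.2

lemma dist_add_dist (h : IsGeodesicSegment S x y) (hp : p ∈ S) :
    dist x p + dist p y = dist x y := by
  obtain ⟨L, σ, hL, rfl, rfl, hσ, rfl⟩ := h
  obtain ⟨s, hs, rfl⟩ := hp
  rw [hσ _ ⟨le_rfl, hL⟩ _ hs, hσ _ hs _ ⟨hL, le_rfl⟩, hσ _ ⟨le_rfl, hL⟩ _ ⟨hL, le_rfl⟩,
    abs_sub_comm 0 s, abs_sub_comm s L, abs_sub_comm 0 L, sub_zero, sub_zero, abs_of_nonneg hs.1,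
    abs_of_nonneg hL, abs_of_nonneg (sub_nonneg.2 hs.2)]
  ring

lemma exists_dist_le_of_infDist_le (h : IsGeodesicSegment S x y) {q : E} {r : ℝ}
    (hq : Metric.infDist q S ≤ r) : ∃ p ∈ S, dist q p ≤ r := by
  obtain ⟨p, hp, hd⟩ := h.isCompact.exists_infDist_eq_dist ⟨x, h.left_mem⟩ q
  exact ⟨p, hp, hd ▸ hq⟩

end IsGeodesicSegment

end Segments

/-! ### Thin triangles and Gromov products -/

section Hyperbolic

variable {E : Type*} [MetricSpace E] {δ : ℝ}

/-- Since segments are compact, the distance in the definition of a thin triangle is attained. -/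
lemma IsHyperbolic.exists_dist_le (hδ : IsHyperbolic E δ) {x y z : E} {XY XZ YZ : Set E}
    (hxy : IsGeodesicSegment XY x y) (hxz : IsGeodesicSegment XZ x z)
    (hyz : IsGeodesicSegment YZ y z) {p : E} (hp : p ∈ XY) :
    ∃ q ∈ XZ ∪ YZ, dist p q ≤ δ := by
  obtain ⟨q, hq, hd⟩ := (hxz.isCompact.union hyz.isCompact).exists_infDist_eq_dist
    ⟨x, Or.inl hxz.left_mem⟩ p
  exact ⟨q, hq, hd ▸ hδ x y z XY XZ YZ hxy hxz hyz p hp⟩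

lemma IsHyperbolic.nonneg (hE : IsGeodesicSpace E) (hδ : IsHyperbolic E δ) (x : E) : 0 ≤ δ := by
  obtain ⟨S, hS⟩ := hE x x
  exact Metric.infDist_nonneg.trans (hδ x x x S S S hS hS hS x hS.left_mem)

/-- Gromov product of `x` and `y` based at `w`. -/
noncomputable def gromovProd (w x y : E) : ℝ := (dist x w + dist y w - dist x y) / 2

lemma gromovProd_comm (w x y : E) : gromovProd w x y = gromovProd w y x := by
  simp only [gromovProd, dist_comm x y]
  ring

lemma gromovProd_le_left (w x y : E) : gromovProd w x y ≤ dist x w := by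
  have := dist_triangle_left y w x
  simp only [gromovProd]
  linarith

lemma gromovProd_le_right (w x y : E) : gromovProd w x y ≤ dist y w := by
  rw [gromovProd_comm]
  exact gromovProd_le_left w y x

lemma gromovProd_le_add_dist (w x x' y : E) :
    gromovProd w x y ≤ gromovProd w x' y + dist x x' := by
  have h1 := dist_triangle x x' w
  have h2 := dist_triangle_left x' y x
  simp only [gromovProd]
  linarith

lemma gromovProd_le_dist {w x y p : E} {S : Set E} (hS : IsGeodesicSegment S x y) (hp : p ∈ S) :
    gromovProd w x y ≤ dist w p := by
  have h := hS.dist_add_dist hp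
  have h1 := dist_triangle x p w
  have h2 := dist_triangle_right y w p
  rw [dist_comm y p] at h2
  rw [dist_comm p w] at h1
  simp only [gromovProd]
  linarith

/-- A point of `[x, y]` has a larger Gromov product with `x` than `y` has. -/
lemma gromovProd_le_gromovProd_of_mem {w x y p : E} {S : Set E} (hS : IsGeodesicSegment S x y)
    (hp : p ∈ S) : gromovProd w x y ≤ gromovProd w x p := by
  have h := hS.dist_add_dist hp
  have h1 := dist_triangle_left y w p
  simp only [gromovProd]
  linarith

/-- The distance to a side exceeds the Gromov product by at most `2δ`: by connectedness some point
of the side is `δ`-close to both of the other sides. -/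
lemma exists_mem_dist_le_gromovProd (hE : IsGeodesicSpace E) (hδ : IsHyperbolic E δ)
    (w : E) {x y : E} {S : Set E} (hS : IsGeodesicSegment S x y) :
    ∃ p ∈ S, dist w p ≤ gromovProd w x y + 2 * δ := by
  obtain ⟨T, hT⟩ := hE x w
  obtain ⟨U, hU⟩ := hE y w
  have h0 : 0 ≤ δ := hδ.nonneg hE x
  have hcl : ∀ V : Set E, IsClosed {p : E | Metric.infDist p V ≤ δ} := fun V =>
    isClosed_le (Metric.continuous_infDist_pt V) continuous_const
  obtain ⟨p, hp, hpT, hpU⟩ := isPreconnected_closed_iff.1 hS.isPreconnected _ _ (hcl T) (hcl U)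
    (by
      intro p hp
      obtain ⟨q, hq | hq, hd⟩ := hδ.exists_dist_le hS hT hU hp
      · exact Or.inl ((Metric.infDist_le_dist_of_mem hq).trans hd)
      · exact Or.inr ((Metric.infDist_le_dist_of_mem hq).trans hd))
    ⟨x, hS.left_mem, by simpa [Metric.infDist_zero_of_mem hT.left_mem] using h0⟩
    ⟨y, hS.right_mem, by simpa [Metric.infDist_zero_of_mem hU.left_mem] using h0⟩
  obtain ⟨q, hq, hpq⟩ := hT.exists_dist_le_of_infDist_le hpT
  obtain ⟨r, hr, hpr⟩ := hU.exists_dist_le_of_infDist_le hpU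
  refine ⟨p, hp, ?_⟩
  have e1 := hT.dist_add_dist hq
  have e2 := hU.dist_add_dist hr
  have t1 := dist_triangle p q w
  have t2 := dist_triangle p r w
  have t3 := dist_triangle_right x p q
  have t4 := dist_triangle_right y p r
  have t5 := dist_triangle_right x y p
  rw [dist_comm w p]
  simp only [gromovProd]
  linarith

/-- Gromov's four point inequality. -/
lemma min_gromovProd_le (hE : IsGeodesicSpace E) (hδ : IsHyperbolic E δ) (w x y z : E) :
    min (gromovProd w x z) (gromovProd w z y) ≤ gromovProd w x y + 3 * δ := by
  obtain ⟨S, hS⟩ := hE x y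
  obtain ⟨T, hT⟩ := hE x z
  obtain ⟨U, hU⟩ := hE y z
  obtain ⟨p, hp, hpd⟩ := exists_mem_dist_le_gromovProd hE hδ w hS
  obtain ⟨q, hq, hd⟩ := hδ.exists_dist_le hS hT hU hp
  have ht := dist_triangle w p q
  rcases hq with hq | hq
  · have := gromovProd_le_dist (w := w) hT hq
    exact (min_le_left _ _).trans (by linarith)
  · have := gromovProd_le_dist (w := w) hU.symm hq
    exact (min_le_right _ _).trans (by linarith)

lemma le_gromovProd_of_chain (hE : IsGeodesicSpace E) (hδ : IsHyperbolic E δ) {w a b c d : E}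
    {r : ℝ} (h₁ : r ≤ gromovProd w a b) (h₂ : r ≤ gromovProd w b c) (h₃ : r ≤ gromovProd w c d) :
    r ≤ gromovProd w a d + 6 * δ := by
  have h0 : 0 ≤ δ := hδ.nonneg hE a
  have e1 := min_gromovProd_le hE hδ w a c b
  have e2 := min_gromovProd_le hE hδ w a d c
  rw [min_le_iff] at e1 e2
  rcases e1 with e1 | e1 <;> rcases e2 with e2 | e2 <;> linarith

end Hyperbolic

/-! ### Discrete quasi-geodesics -/

/-- The points `X 0, …, X n` form a discrete quasi-geodesic. This is what a `(lam, c)`-quasi-geodesic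
becomes when it is sampled with step `δ / lam`, for `Λ = lam ^ 2`; with this step one unit of the
index corresponds to at most `δ` in space, and `lam` enters through its square only. -/
structure IsDiscreteQuasiGeodesic {E : Type*} [MetricSpace E] (δ Λ c : ℝ) (n : ℕ) (X : ℕ → E) :
    Prop where
  upper : ∀ i j : ℕ, i ≤ j → j ≤ n → dist (X i) (X j) ≤ δ * (j - i) + c
  lower : ∀ i j : ℕ, i ≤ j → j ≤ n → δ * (j - i) ≤ Λ * (dist (X i) (X j) + c)

section Discrete

variable {E : Type*} [MetricSpace E] {δ Λ c : ℝ} {n : ℕ} {X : ℕ → E}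

namespace IsDiscreteQuasiGeodesic

lemma dist_succ_le (hX : IsDiscreteQuasiGeodesic δ Λ c n X) {i : ℕ} (hi : i + 1 ≤ n) :
    dist (X i) (X (i + 1)) ≤ c + δ := by
  have := hX.upper i (i + 1) (Nat.le_succ i) hi
  push_cast at this
  linarith

lemma c_nonneg (hX : IsDiscreteQuasiGeodesic δ Λ c n X) : 0 ≤ c := by
  simpa using hX.upper 0 0 le_rfl (Nat.zero_le n)

/-- Cutting the path into halves `m` times: a path of at most `2 ^ m` steps comes within about
`m * δ` of every point of the geodesic joining its endpoints. -/
lemma exists_dist_le_of_le_two_pow (hE : IsGeodesicSpace E) (hδ : IsHyperbolic E δ)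
    (hX : IsDiscreteQuasiGeodesic δ Λ c n X) (m : ℕ) :
    ∀ {i j : ℕ}, i ≤ j → j ≤ n → j - i ≤ 2 ^ m → ∀ {S : Set E}, IsGeodesicSegment S (X i) (X j) →
      ∀ {q : E}, q ∈ S → ∃ k, i ≤ k ∧ k ≤ j ∧ dist q (X k) ≤ m * δ + (c + δ) / 2 := by
  induction m with
  | zero =>
    intro i j hij hj hN S hS q hq
    have hd : dist (X i) (X j) ≤ c + δ := by
      rcases hij.eq_or_lt with rfl | h
      · have h0 := hδ.nonneg hE (X i)
        have := hX.c_nonneg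
        rw [dist_self]
        linarith
      · obtain rfl : j = i + 1 := by simp at hN; omega
        exact hX.dist_succ_le hj
    have h := hS.dist_add_dist hq
    rcases le_total (dist (X i) q) (dist q (X j)) with h' | h'
    · exact ⟨i, le_rfl, hij, by rw [dist_comm]; push_cast; linarith⟩
    · exact ⟨j, hij, le_rfl, by push_cast; linarith⟩
  | succ m ih =>
    intro i j hij hj hN S hS q hq
    have hpow : 2 ^ (m + 1) = 2 * 2 ^ m := by ring
    obtain ⟨T, hT⟩ := hE (X i) (X ((i + j) / 2))
    obtain ⟨U, hU⟩ := hE (X ((i + j) / 2)) (X j)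
    obtain ⟨r, hr, hd⟩ := hδ.exists_dist_le hS hT hU.symm hq
    rcases hr with hr | hr
    · obtain ⟨k, hk1, hk2, hk⟩ := ih (by omega) (by omega) (by omega) hT hr
      refine ⟨k, hk1, by omega, ?_⟩
      have := dist_triangle q r (X k)
      push_cast
      linarith
    · obtain ⟨k, hk1, hk2, hk⟩ := ih (by omega) (by omega) (by omega) hU hr
      refine ⟨k, by omega, hk2, ?_⟩
      have := dist_triangle q r (X k)
      push_cast
      linarith

end IsDiscreteQuasiGeodesic

end Discrete

/-! ### Numerical estimates -/

section Numerics

open Real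

/-- The gain of the potential `48 * Λ * K * (1 - exp (-k / (Λ * K)))` when a path of `t` steps is
prolonged by `s ≥ 2 ^ a / 2` steps. -/
lemma exp_neg_mul_two_pow_le {Λ K : ℝ} (hΛ : 1 ≤ Λ) (hK : 20 ≤ K) {a : ℕ} (ha : 1 ≤ a)
    (haK : exp (2 * a / K) ≤ Λ * K) {s t : ℝ} (ht : t ≤ Λ * (2 * a + K)) (hs : 2 ^ a ≤ 2 * s) :
    6 ≤ 48 * (Λ * K) * (exp (-(t / (Λ * K))) - exp (-((t + s) / (Λ * K)))) := by
  have hY : 0 < Λ * K := by nlinarith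
  set Y := Λ * K with hYdef
  have hspos : 0 < s := by have : (0:ℝ) < 2 ^ a := by positivity
                           linarith
  -- the factor `exp (-t / Y)` is at least `exp (-2a / K) / e`
  have h1 : exp (-(2 * a / K)) * exp (-1) ≤ exp (-(t / Y)) := by
    rw [← exp_add]
    apply exp_le_exp.2
    have : t / Y ≤ 2 * a / K + 1 := by
      rw [div_le_iff₀ hY]
      have : (2 * a / K + 1) * Y = Λ * (2 * a + K) := by
        rw [hYdef]; field_simp
      linarith
    linarith
  -- `1 - exp (-x) ≥ x / (1 + x)`
  have h2 : s / (Y + s) ≤ 1 - exp (-(s / Y)) := by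
    have hx : 1 + s / Y ≤ exp (s / Y) := by linarith [add_one_le_exp (s / Y)]
    have hx0 : 0 < 1 + s / Y := by positivity
    have : exp (-(s / Y)) ≤ (1 + s / Y)⁻¹ := by
      rw [exp_neg]
      exact inv_anti₀ hx0 hx
    have e : (1 + s / Y)⁻¹ = 1 - s / (Y + s) := by field_simp; ring
    linarith
  have h3 : exp (-((t + s) / Y)) = exp (-(t / Y)) * exp (-(s / Y)) := by
    rw [← exp_add]
    congr 1
    ring
  have he : 9 / 25 ≤ exp (-1 : ℝ) := by
    rw [exp_neg, le_inv_comm₀ (by norm_num) (exp_pos 1)]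
    linarith [exp_one_lt_d9]
  -- the factor `exp (-2a / K)` is compensated by `2 ^ a`, or by `Y` once `s` exceeds `Y`
  have h4 : 9 / 20 / Y ≤ exp (-(2 * a / K)) * (s / (Y + s)) := by
    rcases le_total s Y with hsY | hsY
    · have hb : (9 / 10 : ℝ) ^ a ≤ exp (-(2 * a / K)) := by
        have e1 : exp (-(2 * a / K)) ≥ exp (-(1 / 10)) ^ a := by
          rw [← exp_nat_mul]
          apply exp_le_exp.2
          have : 2 * (a : ℝ) / K ≤ 2 * a / 20 := by gcongr
          linarith
        have e2 : (9 / 10 : ℝ) ≤ exp (-(1 / 10)) := by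
          linarith [add_one_le_exp (-(1 / 10) : ℝ)]
        exact (pow_le_pow_left₀ (by norm_num) e2 a).trans e1
      have hb2 : 9 / 10 ≤ exp (-(2 * a / K)) * s := by
        have e1 : (9 / 5 : ℝ) ≤ (9 / 5) ^ a := le_self_pow₀ (by norm_num) (by omega)
        have e2 : (9 / 5 : ℝ) ^ a = (9 / 10) ^ a * 2 ^ a := by rw [← mul_pow]; norm_num
        have e3 : (9 / 10 : ℝ) ^ a * 2 ^ a ≤ exp (-(2 * a / K)) * (2 * s) := by gcongr
        linarith
      rw [← mul_div_assoc, div_le_div_iff₀ hY (by positivity)]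
      nlinarith
    · have hb : 1 / Y ≤ exp (-(2 * a / K)) := by
        rw [exp_neg, one_div]
        exact inv_anti₀ (exp_pos _) haK
      have hb2 : 9 / 20 ≤ s / (Y + s) := by
        rw [le_div_iff₀ (by positivity)]
        linarith
      calc 9 / 20 / Y = 1 / Y * (9 / 20) := by ring
        _ ≤ _ := by gcongr
  have h5 : 9 / 20 / Y * (9 / 25) ≤ exp (-(t / Y)) * (1 - exp (-(s / Y))) := by
    calc 9 / 20 / Y * (9 / 25) ≤ exp (-(2 * a / K)) * (s / (Y + s)) * exp (-1) := by gcongr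
      _ = exp (-(2 * a / K)) * exp (-1) * (s / (Y + s)) := by ring
      _ ≤ _ := by gcongr
  rw [h3]
  calc (6 : ℝ) ≤ 48 * (81 / 500) := by norm_num
    _ = 48 * Y * (9 / 20 / Y * (9 / 25)) := by field_simp; norm_num
    _ ≤ 48 * Y * (exp (-(t / Y)) * (1 - exp (-(s / Y)))) := by gcongr
    _ = _ := by ring

/-- The value `M = ⌊10 * log (Λ * (5 * C + 20))⌋` is large enough for the logarithmic estimate, and
small enough for the hypothesis of `exp_neg_mul_two_pow_le`. -/
lemma exists_nat_exp_le_and_le_two_pow {Λ C : ℝ} (hΛ : 1 ≤ Λ) (hC : 0 ≤ C) :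
    ∃ M : ℕ, exp (2 * M / (5 * C + 20)) ≤ Λ * (5 * C + 20) ∧
      4 * (Λ * (6 * M + 7 * C + 12) + 1) ≤ 2 ^ M := by
  set K := 5 * C + 20 with hK
  set Y := Λ * K with hY
  have hK20 : 20 ≤ K := by linarith
  have hY20 : 20 ≤ Y := by nlinarith
  have hYpos : 0 < Y := by linarith
  have hlog : 0 ≤ log Y := log_nonneg (by linarith)
  have hM1 : (⌊10 * log Y⌋₊ : ℝ) ≤ 10 * log Y := Nat.floor_le (by positivity)
  have hM2 := Nat.lt_floor_add_one (10 * log Y)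
  refine ⟨⌊10 * log Y⌋₊, ?_, ?_⟩
  · rw [← le_log_iff_exp_le hYpos, div_le_iff₀ (by linarith)]
    nlinarith
  · set M := ⌊10 * log Y⌋₊
    have h1 : Y ^ 6 ≤ 2 * 2 ^ M := by
      have e1 : (2 : ℝ) * 2 ^ M = exp (log 2 * ((M : ℝ) + 1)) := by
        rw [← pow_succ', mul_comm, ← Nat.cast_succ, exp_nat_mul, exp_log (by norm_num)]
      have e2 : Y ^ 6 = exp (6 * log Y) := by
        rw [← exp_log (pow_pos hYpos 6), log_pow]
        norm_num
      rw [e1, e2]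
      apply exp_le_exp.2
      nlinarith [log_two_gt_d9]
    have h2 : (M : ℝ) ≤ 10 * Y := by linarith [log_le_sub_one_of_pos hYpos]
    have h3 : 20 * Λ ≤ Y := by nlinarith
    have h4 : Λ * (6 * M + 7 * C + 12) + 1 ≤ 3 * Y ^ 2 + 2 * Y := by
      have : Λ * M ≤ Y ^ 2 / 2 := by
        calc Λ * M ≤ Y / 20 * (10 * Y) := by gcongr; linarith
          _ = _ := by ring
      have : Λ * (7 * C + 12) ≤ Λ * (K * (7 / 5)) := by gcongr; linarith
      nlinarith
    have h5 : 400 ≤ Y ^ 2 := by nlinarith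
    have h6 : 400 * 400 * Y ^ 2 ≤ Y ^ 6 := by
      calc 400 * 400 * Y ^ 2 ≤ Y ^ 2 * Y ^ 2 * Y ^ 2 := by gcongr
        _ = _ := by ring
    nlinarith

end Numerics

section Discrete

variable {E : Type*} [MetricSpace E] {δ Λ c : ℝ} {n : ℕ} {X : ℕ → E}

/-! ### The geodesic stays close to the quasi-geodesic -/

namespace IsDiscreteQuasiGeodesic

/-- The logarithmic half of the Morse lemma: the geodesic `[X i, X j]` lies in the neighbourhood of
radius `δ * M + c + δ` of the path, where `M` is of the order of `log Λ`. At a point `p` of the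
geodesic at maximal distance `D` from the path, points of the path close to the geodesic
at distance `2 * D` on both sides of `p` are separated by at most `Λ * (6 * D + c) / δ` steps, so
that `D` is bounded by `δ` times the logarithm of this number. -/
lemma exists_dist_le (hE : IsGeodesicSpace E) (hδ : IsHyperbolic E δ) (hδ0 : 0 < δ) (hΛ : 1 ≤ Λ)
    (hX : IsDiscreteQuasiGeodesic δ Λ c n X) {M : ℕ}
    (hM : 4 * (Λ * (6 * M + 7 * (c / δ) + 12) + 1) ≤ (2 : ℝ) ^ M)
    {i j : ℕ} (hij : i ≤ j) (hj : j ≤ n) {S : Set E} (hS : IsGeodesicSegment S (X i) (X j))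
    {q : E} (hq : q ∈ S) : ∃ k, i ≤ k ∧ k ≤ j ∧ dist q (X k) ≤ δ * M + (c + δ) := by
  have hc := hX.c_nonneg
  set A : Set E := X '' Icc i j with hA
  have hAc : IsCompact A := ((finite_Icc i j).image X).isCompact
  have hAi : X i ∈ A := ⟨i, ⟨le_rfl, hij⟩, rfl⟩
  have hAj : X j ∈ A := ⟨j, ⟨hij, le_rfl⟩, rfl⟩
  have hnear : ∀ y : E, ∃ k, i ≤ k ∧ k ≤ j ∧ dist y (X k) = Metric.infDist y A := by
    intro y
    obtain ⟨_, ⟨k, hk, rfl⟩, hd⟩ := hAc.exists_infDist_eq_dist ⟨_, hAi⟩ y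
    exact ⟨k, hk.1, hk.2, hd.symm⟩
  obtain ⟨p, hp, hmax⟩ := hS.isCompact.exists_isMaxOn ⟨q, hq⟩
    (Metric.continuous_infDist_pt A).continuousOn
  set D := Metric.infDist p A with hD
  by_contra! hcon
  have hDM : δ * M + (c + δ) < D := by
    obtain ⟨k, hk1, hk2, hk⟩ := hnear q
    calc _ < dist q (X k) := hcon k hk1 hk2
      _ = _ := hk
      _ ≤ D := hmax hq
  have hDk : ∀ k, i ≤ k → k ≤ j → D ≤ dist p (X k) := fun k h1 h2 =>
    Metric.infDist_le_dist_of_mem ⟨k, ⟨h1, h2⟩, rfl⟩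
  have hD0 : 0 < D := by have : 0 ≤ δ * M := by positivity
                         linarith
  -- `k` is the integral part of the excess of `D / δ` over `c / δ + 1`
  set k := ⌊(D - c - δ) / δ⌋₊ with hk
  have hpos : 0 ≤ (D - c - δ) / δ := by
    have : 0 ≤ δ * M := by positivity
    apply div_nonneg <;> linarith
  have hMk : M ≤ k := by
    apply Nat.le_floor
    rw [le_div_iff₀ hδ0]
    linarith
  have hk1 : δ * k + c + δ ≤ D := by
    have := Nat.floor_le hpos
    rw [le_div_iff₀ hδ0] at this
    linarith
  have hk2 : D ≤ δ * k + c + 2 * δ := by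
    have := (Nat.lt_floor_add_one ((D - c - δ) / δ)).le
    rw [div_le_iff₀ hδ0] at this
    linarith
  have hpow : 4 * (Λ * (6 * k + 7 * (c / δ) + 12) + 1) ≤ (2 : ℝ) ^ k := by
    clear_value k
    clear hk hk1 hk2
    induction hMk with
    | refl => exact hM
    | @step k _ ih =>
      have : 0 ≤ Λ * k := by positivity
      have : 0 ≤ Λ * (c / δ) := by positivity
      rw [pow_succ]
      push_cast
      linarith
  have hk2' : 2 ≤ k := by
    by_contra! h
    have h1 : (2 : ℝ) ^ k ≤ 2 ^ 1 := pow_le_pow_right₀ (by norm_num) (by omega)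
    have : 0 ≤ Λ * k := by positivity
    have : 0 ≤ Λ * (c / δ) := by positivity
    linarith
  have hstep : ∀ {a b : ℕ}, a ≤ b → b ≤ n → dist (X a) (X b) ≤ 6 * D → b - a ≤ 2 ^ (k - 2) := by
    intro a b hab hb hd
    have h1 := hX.lower a b hab hb
    have h2 : δ * ((b : ℝ) - a) ≤ δ * (Λ * (6 * k + 7 * (c / δ) + 12)) := by
      calc _ ≤ _ := h1
        _ ≤ Λ * (6 * (δ * k + c + 2 * δ) + c) := by gcongr; linarith
        _ = _ := by field_simp; ring
    have h3 : (b : ℝ) - a ≤ Λ * (6 * k + 7 * (c / δ) + 12) := le_of_mul_le_mul_left h2 hδ0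
    have h4 : (2 : ℝ) ^ k = 4 * 2 ^ (k - 2) := by
      rw [show (4 : ℝ) = 2 ^ 2 by norm_num, ← pow_add]
      congr 1
      omega
    have h5 : ((b - a : ℕ) : ℝ) ≤ ((2 ^ (k - 2) : ℕ) : ℝ) := by
      rw [Nat.cast_sub hab]
      push_cast
      linarith
    exact_mod_cast h5
  obtain ⟨L, σ, hL, hσ0, hσL, hσ, hSσ⟩ := id hS
  obtain ⟨s, hs, hps⟩ : p ∈ σ '' Icc 0 L := hSσ ▸ hp
  -- the short connection from the geodesic to the path avoids the ball of radius `D` around `p`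
  have hside : ∀ u ∈ Icc 0 L, (2 * D ≤ |s - u| ∨ u = 0 ∨ u = L) →
      ∃ a, i ≤ a ∧ a ≤ j ∧ dist (σ u) (X a) ≤ D ∧
        ∀ T : Set E, IsGeodesicSegment T (σ u) (X a) → ∀ r ∈ T, D ≤ dist p r := by
    have hend : ∀ a, i ≤ a → a ≤ j → ∃ b, i ≤ b ∧ b ≤ j ∧ dist (X a) (X b) ≤ D ∧
        ∀ T : Set E, IsGeodesicSegment T (X a) (X b) → ∀ r ∈ T, D ≤ dist p r := by
      intro a h1 h2
      refine ⟨a, h1, h2, by simpa using hD0.le, fun T hT r hr => ?_⟩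
      have h := hT.dist_add_dist hr
      rw [dist_self] at h
      have : dist (X a) r = 0 := by
        linarith [dist_nonneg (x := X a) (y := r), dist_nonneg (x := r) (y := X a)]
      rw [← dist_eq_zero.1 this]
      exact hDk a h1 h2
    rintro u hu (hsu | rfl | rfl)
    · obtain ⟨a, h1, h2, ha⟩ := hnear (σ u)
      have haD : dist (σ u) (X a) ≤ D := ha.le.trans (hmax (hSσ ▸ mem_image_of_mem σ hu))
      refine ⟨a, h1, h2, haD, fun T hT r hr => ?_⟩
      have h := hT.dist_add_dist hr
      have h3 : 2 * D ≤ dist p (σ u) := by rw [← hps, hσ s hs u hu]; exact hsu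
      have h4 := dist_triangle_right p (σ u) r
      linarith [dist_nonneg (x := r) (y := X a)]
    · rw [hσ0]
      exact hend i le_rfl hij
    · rw [hσL]
      exact hend j hij le_rfl
  set s₁ := max (s - 2 * D) 0 with hs₁
  set s₂ := min (s + 2 * D) L with hs₂
  have h1s : s₁ ≤ s := max_le (by linarith) hs.1
  have hs2 : s ≤ s₂ := le_min (by linarith) hs.2
  have hm1 : s₁ ∈ Icc 0 L := ⟨le_max_right _ _, h1s.trans hs.2⟩
  have hm2 : s₂ ∈ Icc 0 L := ⟨hs.1.trans hs2, min_le_right _ _⟩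
  have h12 : dist (σ s₁) (σ s₂) ≤ 4 * D := by
    rw [hσ _ hm1 _ hm2, abs_sub_comm, abs_of_nonneg (by linarith)]
    linarith [le_max_left (s - 2 * D) 0, min_le_left (s + 2 * D) L]
  obtain ⟨a, ha1, ha2, haD, haT⟩ := hside s₁ hm1 (by
    rcases max_choice (s - 2 * D) 0 with h | h
    · left; rw [hs₁, h, show s - (s - 2 * D) = 2 * D by ring]; exact le_abs_self _
    · exact Or.inr (Or.inl h))
  obtain ⟨b, hb1, hb2, hbD, hbT⟩ := hside s₂ hm2 (by
    rcases min_choice (s + 2 * D) L with h | h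
    · left; rw [hs₂, h, show s - (s + 2 * D) = -(2 * D) by ring, abs_neg]; exact le_abs_self _
    · exact Or.inr (Or.inr h))
  have hab : dist (X a) (X b) ≤ 6 * D := by
    have t1 := dist_triangle4 (X a) (σ s₁) (σ s₂) (X b)
    rw [dist_comm (X a) (σ s₁)] at t1
    linarith
  obtain ⟨T₁, hT₁⟩ := hE (σ s₁) (X a)
  obtain ⟨T₂, hT₂⟩ := hE (σ s₂) (X b)
  obtain ⟨V, hV⟩ := hE (X a) (σ s₂)
  obtain ⟨W, hW⟩ := hE (X a) (X b)
  -- the segment between the two points of the path comes within `2 * δ` of `p`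
  obtain ⟨r, hr, hpr⟩ : ∃ r ∈ W, dist p r ≤ 2 * δ := by
    have hbig : 2 * δ < D := by
      have : δ * 2 ≤ δ * k := by gcongr; exact_mod_cast hk2'
      linarith
    obtain ⟨r, hr | hr, hd⟩ := hδ.exists_dist_le (isGeodesicSegment_image hσ hm1.1 (h1s.trans hs2)
      hm2.2) hT₁ hV.symm (⟨s, ⟨h1s, hs2⟩, hps⟩ : p ∈ σ '' Icc s₁ s₂)
    · linarith [haT T₁ hT₁ r hr]
    · obtain ⟨r', hr' | hr', hd'⟩ := hδ.exists_dist_le hV hW hT₂ hr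
      · exact ⟨r', hr', by linarith [dist_triangle p r r']⟩
      · linarith [hbT T₂ hT₂ r' hr', dist_triangle p r r']
  obtain ⟨e, he1, he2, he⟩ : ∃ e, i ≤ e ∧ e ≤ j ∧
      dist r (X e) ≤ (k - 2 : ℕ) * δ + (c + δ) / 2 := by
    rcases le_total a b with hle | hle
    · obtain ⟨e, h1, h2, h3⟩ := hX.exists_dist_le_of_le_two_pow hE hδ (k - 2) hle (hb2.trans hj)
        (hstep hle (hb2.trans hj) hab) hW hr
      exact ⟨e, by omega, by omega, h3⟩
    · obtain ⟨e, h1, h2, h3⟩ := hX.exists_dist_le_of_le_two_pow hE hδ (k - 2) hle (ha2.trans hj)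
        (hstep hle (ha2.trans hj) (by rwa [dist_comm])) hW.symm hr
      exact ⟨e, by omega, by omega, h3⟩
  have h1 := hDk e he1 he2
  have h2 := dist_triangle p r (X e)
  rw [Nat.cast_sub hk2'] at he
  push_cast at he
  nlinarith

/-- Either the path is long, or it passes close to the given point of the geodesic:
`2 ^ a` is a lower bound for the length that goes with the distance `δ * a`. -/
lemma exists_dist_le_and_two_pow_le (hE : IsGeodesicSpace E) (hδ : IsHyperbolic E δ) (hδ0 : 0 < δ)
    (hΛ : 1 ≤ Λ) (hX : IsDiscreteQuasiGeodesic δ Λ c n X) {M : ℕ}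
    (hM : 4 * (Λ * (6 * M + 7 * (c / δ) + 12) + 1) ≤ (2 : ℝ) ^ M)
    {i j : ℕ} (hij : i ≤ j) (hj : j ≤ n) {S : Set E} (hS : IsGeodesicSegment S (X i) (X j))
    {q : E} (hq : q ∈ S) : ∃ a k : ℕ, a ≤ M ∧ (a = 0 ∨ 2 ^ a ≤ 2 * (j - i)) ∧ i ≤ k ∧ k ≤ j ∧
      dist q (X k) ≤ δ * a + (c + δ) := by
  have hc := hX.c_nonneg
  rcases le_total M (Nat.clog 2 (j - i)) with hle | hle
  · obtain ⟨k, h1, h2, h3⟩ := hX.exists_dist_le hE hδ hδ0 hΛ hM hij hj hS hq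
    refine ⟨M, k, le_rfl, ?_, h1, h2, h3⟩
    rcases Nat.eq_zero_or_pos M with h | h
    · exact Or.inl h
    · right
      have := Nat.pow_lt_of_lt_clog (b := 2) (x := j - i) (y := M - 1) (by omega)
      have h2 := mul_pow_sub_one h.ne' 2
      omega
  · obtain ⟨k, h1, h2, h3⟩ := hX.exists_dist_le_of_le_two_pow hE hδ (Nat.clog 2 (j - i)) hij hj
      (Nat.le_pow_clog (by norm_num) _) hS hq
    refine ⟨_, k, hle, ?_, h1, h2, by nlinarith⟩
    rcases Nat.eq_zero_or_pos (Nat.clog 2 (j - i)) with h | h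
    · exact Or.inl h
    · right
      have := Nat.pow_lt_of_lt_clog (b := 2) (x := j - i) (y := Nat.clog 2 (j - i) - 1) (by omega)
      have h2 := mul_pow_sub_one h.ne' 2
      omega

end IsDiscreteQuasiGeodesic

/-! ### The quasi-geodesic stays close to the geodesic -/

/-- A discrete intermediate value property for a sequence that drops by at most `J` at each step. -/
lemma exists_crossing {g : ℕ → ℝ} {R J : ℝ} {m : ℕ} (h0 : R ≤ g 0) (hm : g m < R)
    (hstep : ∀ k < m, g k ≤ g (k + 1) + J) : ∃ k < m, R ≤ g k ∧ g k ≤ R + J := by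
  classical
  have hex : ∃ k, g k < R := ⟨m, hm⟩
  have hlt := Nat.find_spec hex
  have hle : Nat.find hex ≤ m := Nat.find_min' hex hm
  obtain ⟨k, hk⟩ : ∃ k, Nat.find hex = k + 1 := by
    refine Nat.exists_eq_succ_of_ne_zero fun h => ?_
    rw [h] at hlt
    linarith
  rw [hk] at hlt hle
  have := hstep k (by omega)
  exact ⟨k, by omega, not_lt.1 (Nat.find_min hex (by omega)), by linarith⟩

namespace IsDiscreteQuasiGeodesic

/-- The Morse lemma for discrete quasi-geodesics, in terms of Gromov products. The bound increases
with the length `j - i` of the path, but stays below a multiple of `Λ` that does not depend on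
this length; the exponential term pays for the `6 * δ` lost in each inductive step. -/
lemma gromovProd_le (hE : IsGeodesicSpace E) (hδ : IsHyperbolic E δ) (hδ0 : 0 < δ) (hΛ : 1 ≤ Λ)
    (hX : IsDiscreteQuasiGeodesic δ Λ c n X) {p : ℕ} {i j : ℕ} (hip : i ≤ p) (hpj : p ≤ j)
    (hj : j ≤ n) :
    gromovProd (X p) (X i) (X j) ≤ Λ * (7 / 2 * c + 16 * δ) +
      δ * (48 * (Λ * (5 * (c / δ) + 20)) *
        (1 - Real.exp (-(((j : ℝ) - i) / (Λ * (5 * (c / δ) + 20)))))) := by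
  have hc := hX.c_nonneg
  have hcδ : 0 ≤ c / δ := by positivity
  obtain ⟨M, hM1, hM2⟩ := exists_nat_exp_le_and_le_two_pow hΛ hcδ
  set K := 5 * (c / δ) + 20 with hK
  have hY : 0 < Λ * K := by positivity
  induction hN : j - i using Nat.strong_induction_on generalizing i j with
  | _ N ih =>
  by_contra! hcon
  set R := gromovProd (X p) (X i) (X j) with hR
  have hbase : Λ * (7 / 2 * c + 16 * δ) < R := by
    refine lt_of_le_of_lt (le_add_of_nonneg_right ?_) hcon
    have : Real.exp (-(((j : ℝ) - i) / (Λ * K))) ≤ 1 := by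
      rw [Real.exp_le_one_iff, neg_nonpos]
      have : (i : ℝ) ≤ j := by exact_mod_cast hip.trans hpj
      apply div_nonneg <;> linarith
    have : 0 ≤ 1 - Real.exp (-(((j : ℝ) - i) / (Λ * K))) := by linarith
    positivity
  have hR0 : 0 < R := lt_of_le_of_lt (by positivity) hbase
  have hself : ∀ x : E, gromovProd (X p) (X p) x < R := fun x =>
    lt_of_le_of_lt (by simpa using gromovProd_le_left (X p) (X p) x) hR0
  have hdiag : ∀ x : E, gromovProd (X p) x x = dist x (X p) := fun x => by
    simp [gromovProd]
  -- move both endpoints towards `p` as long as their Gromov product with the old ones is `≥ R`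
  obtain ⟨i', hi1, hi2, hiR, hiJ⟩ : ∃ i', i ≤ i' ∧ i' ≤ p ∧
      R ≤ gromovProd (X p) (X i) (X i') ∧ gromovProd (X p) (X i) (X i') ≤ R + (c + δ) := by
    obtain ⟨k, hk, h1, h2⟩ := exists_crossing
      (g := fun k => gromovProd (X p) (X (i + k)) (X i)) (R := R) (J := c + δ) (m := p - i)
      (by simpa [hdiag] using gromovProd_le_left _ _ _)
      (by simpa [Nat.add_sub_cancel' hip] using hself _)
      (fun k hk => (gromovProd_le_add_dist _ _ _ _).trans
        (add_le_add_right (hX.dist_succ_le (by omega)) _))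
    rw [gromovProd_comm] at h1 h2
    exact ⟨i + k, by omega, by omega, h1, h2⟩
  obtain ⟨j', hj1, hj2, hjR, hjJ⟩ : ∃ j', p ≤ j' ∧ j' ≤ j ∧
      R ≤ gromovProd (X p) (X j) (X j') ∧ gromovProd (X p) (X j) (X j') ≤ R + (c + δ) := by
    obtain ⟨k, hk, h1, h2⟩ := exists_crossing
      (g := fun k => gromovProd (X p) (X (j - k)) (X j)) (R := R) (J := c + δ) (m := j - p)
      (by simpa [hdiag] using gromovProd_le_right _ _ _)
      (by simpa [Nat.sub_sub_self hpj] using hself _)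
      (fun k hk => (gromovProd_le_add_dist _ _ _ _).trans (add_le_add_right (by
        have := hX.dist_succ_le (i := j - (k + 1)) (by omega)
        rwa [show j - (k + 1) + 1 = j - k by omega, dist_comm] at this) _))
    rw [gromovProd_comm] at h1 h2
    exact ⟨j - k, by omega, by omega, h1, h2⟩
  have hloss : R ≤ gromovProd (X p) (X i') (X j') + 6 * δ :=
    le_gromovProd_of_chain hE hδ (by rwa [gromovProd_comm]) le_rfl hjR
  -- the sides `[X i, X i']` and `[X j, X j']` come close to each other
  obtain ⟨S, hS⟩ := hE (X i) (X i')
  obtain ⟨T, hT⟩ := hE (X j') (X j)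
  obtain ⟨q, hq, hqd⟩ := exists_mem_dist_le_gromovProd hE hδ (X p) hS
  obtain ⟨r, hr, hrd⟩ := exists_mem_dist_le_gromovProd hE hδ (X p) hT.symm
  have hqr : dist q r ≤ 2 * c + 18 * δ := by
    have h1 := hiR.trans (gromovProd_le_gromovProd_of_mem hS hq)
    have h2 := hjR.trans (gromovProd_le_gromovProd_of_mem hT.symm hr)
    rw [gromovProd_comm] at h1
    have h := le_gromovProd_of_chain hE hδ h1 hR.le h2
    rw [gromovProd, dist_comm q (X p), dist_comm r (X p)] at h
    linarith
  -- the paths from `i` to `i'` and from `j'` to `j` come close to these points, or one is long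
  obtain ⟨a₁, k₁, ha₁M, ha₁, hk₁, hk₁', hd₁⟩ :=
    hX.exists_dist_le_and_two_pow_le hE hδ hδ0 hΛ hM2 hi1 (by omega) hS hq
  obtain ⟨a₂, k₂, ha₂M, ha₂, hk₂, hk₂', hd₂⟩ :=
    hX.exists_dist_le_and_two_pow_le hE hδ hδ0 hΛ hM2 hj2 hj hT hr
  obtain ⟨a, haM, ha, h1a, h2a⟩ : ∃ a : ℕ, a ≤ M ∧ (a = 0 ∨ 2 ^ a ≤ 2 * ((i' - i) + (j - j'))) ∧
      a₁ ≤ a ∧ a₂ ≤ a := by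
    rcases le_total a₁ a₂ with h | h
    · exact ⟨a₂, ha₂M, ha₂.imp_right fun h' => by omega, h, le_rfl⟩
    · exact ⟨a₁, ha₁M, ha₁.imp_right fun h' => by omega, le_rfl, h⟩
  have hshort : (j' : ℝ) - i' ≤ Λ * (2 * a + K) := by
    have h1 := hX.lower k₁ k₂ (by omega) (by omega)
    have h2 : dist (X k₁) (X k₂) ≤ 2 * (δ * a) + 4 * c + 20 * δ := by
      have t := dist_triangle4 (X k₁) q r (X k₂)
      rw [dist_comm (X k₁) q] at t
      have e1 : δ * a₁ ≤ δ * a := by gcongr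
      have e2 : δ * a₂ ≤ δ * a := by gcongr
      linarith
    have h3 : δ * ((j' : ℝ) - i') ≤ δ * ((k₂ : ℝ) - k₁) := by gcongr
    refine le_of_mul_le_mul_left ?_ hδ0
    calc _ ≤ _ := h3.trans h1
      _ ≤ Λ * (2 * (δ * a) + 4 * c + 20 * δ + c) := by gcongr
      _ = _ := by rw [hK]; field_simp; ring
  rcases Nat.eq_zero_or_pos a with rfl | hapos
  · -- the new endpoints are close to each other, hence to `X p`
    have h1 := gromovProd_le_left (X p) (X i') (X j')
    have h2 := gromovProd_le_right (X p) (X i') (X j')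
    have h3 := hX.upper i' p hi2 (by omega)
    have h4 := hX.upper p j' hj1 (by omega)
    rw [dist_comm] at h4
    have h5 : δ * ((j' : ℝ) - i') ≤ Λ * (5 * c + 20 * δ) := by
      calc _ ≤ δ * (Λ * (2 * (0 : ℕ) + K)) := by gcongr
        _ = _ := by rw [hK]; field_simp; push_cast; ring
    have h6 : 1 * (c + 6 * δ) ≤ Λ * (c + 6 * δ) := by gcongr
    linarith
  · have ha' : (2 : ℝ) ^ a ≤ 2 * (((i' : ℝ) - i) + (j - j')) := by
      have h : 2 ^ a ≤ 2 * ((i' - i) + (j - j')) := ha.resolve_left hapos.ne'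
      rw [← Nat.cast_sub hi1, ← Nat.cast_sub hj2]
      exact_mod_cast h
    have hlt : j' - i' < N := by
      have h : 2 ^ a ≤ 2 * ((i' - i) + (j - j')) := ha.resolve_left hapos.ne'
      have : 0 < 2 ^ a := by positivity
      omega
    have h1 := ih _ hlt hi2 hj1 (hj2.trans hj) rfl
    have haK : Real.exp (2 * a / K) ≤ Λ * K := by
      refine (Real.exp_le_exp.2 ?_).trans hM1
      gcongr
    have hgain := exp_neg_mul_two_pow_le hΛ (by linarith : 20 ≤ K) hapos haK hshort ha'
    rw [show (j' : ℝ) - i' + (((i' : ℝ) - i) + (j - j')) = j - i by ring] at hgain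
    have := mul_le_mul_of_nonneg_left hgain hδ0.le
    linarith

end IsDiscreteQuasiGeodesic

end Discrete

/-! ### Sampling -/

section Sampling

variable {E : Type*} [MetricSpace E] {δ lam c l : ℝ} {γ : ℝ → E}

lemma IsQuasiGeodesic.isDiscreteQuasiGeodesic (hγ : IsQuasiGeodesic lam c l γ) (hlam : 1 ≤ lam)
    (hδ : 0 < δ) {u : ℝ} (hu : 0 ≤ u) {n : ℕ} (hn : u + n * (δ / lam) ≤ l) :
    IsDiscreteQuasiGeodesic δ (lam ^ 2) c n fun k => γ (u + k * (δ / lam)) := by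
  have hlam0 : 0 < lam := by linarith
  have key : ∀ i j : ℕ, i ≤ j → j ≤ n →
      1 / lam * ((j - i) * (δ / lam)) - c ≤ dist (γ (u + i * (δ / lam))) (γ (u + j * (δ / lam))) ∧
      dist (γ (u + i * (δ / lam))) (γ (u + j * (δ / lam))) ≤ lam * ((j - i) * (δ / lam)) + c := by
    intro i j hij hj
    have hmem : ∀ k : ℕ, k ≤ n → u + k * (δ / lam) ∈ Icc 0 l := fun k hk =>
      ⟨by positivity, le_trans (by gcongr) hn⟩
    have hij' : (i : ℝ) ≤ j := by exact_mod_cast hij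
    have h := hγ.2 _ (hmem i (hij.trans hj)) _ (hmem j hj)
    have e : dist (u + i * (δ / lam)) (u + j * (δ / lam)) = (j - i) * (δ / lam) := by
      rw [dist_comm, Real.dist_eq, add_sub_add_left_eq_sub, ← sub_mul, abs_of_nonneg]
      have : 0 ≤ (j : ℝ) - i := by linarith
      positivity
    rwa [e] at h
  refine ⟨fun i j hij hj => ?_, fun i j hij hj => ?_⟩
  · have h := (key i j hij hj).2
    have e : lam * (((j : ℝ) - i) * (δ / lam)) = δ * (j - i) := by field_simp
    rwa [e] at h
  · have h := (key i j hij hj).1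
    have e : δ * ((j : ℝ) - i) = lam ^ 2 * (1 / lam * ((j - i) * (δ / lam))) := by field_simp
    rw [e]
    gcongr
    linarith

lemma IsQuasiGeodesic.gromovProd_le (hE : IsGeodesicSpace E) (hδ : IsHyperbolic E δ) (hδ0 : 0 < δ)
    (hlam : 1 ≤ lam) (hγ : IsQuasiGeodesic lam c l γ) {t : ℝ} (ht : t ∈ Icc 0 l) :
    gromovProd (γ t) (γ 0) (γ l) ≤ lam ^ 2 * (491 / 2 * c + 978 * δ) := by
  have hlam0 : 0 < lam := by linarith
  have hΛ : 1 ≤ lam ^ 2 := one_le_pow₀ hlam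
  set h := δ / lam with hh
  have hh0 : 0 < h := by positivity
  -- the grid contains `t`; its ends are at distance at most `h` from `0` and `l`
  have hp1 := Nat.floor_le (div_nonneg ht.1 hh0.le)
  have hp2 := (Nat.lt_floor_add_one (t / h)).le
  have hr1 := Nat.floor_le (div_nonneg (sub_nonneg.2 ht.2) hh0.le)
  have hr2 := (Nat.lt_floor_add_one ((l - t) / h)).le
  set p := ⌊t / h⌋₊
  set r := ⌊(l - t) / h⌋₊
  rw [le_div_iff₀ hh0] at hp1 hr1
  rw [div_le_iff₀ hh0] at hp2 hr2
  have hX := hγ.isDiscreteQuasiGeodesic hlam hδ0 (u := t - p * h) (by linarith) (n := p + r)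
    (by push_cast; linarith)
  have hmain := hX.gromovProd_le hE hδ hδ0 hΛ (Nat.zero_le p) (Nat.le_add_right p r) le_rfl
  have hc := hX.c_nonneg
  have hclose : ∀ x ∈ Icc 0 l, ∀ y ∈ Icc 0 l, |x - y| ≤ h → dist (γ x) (γ y) ≤ c + δ := by
    intro x hx y hy hxy
    have h1 := (hγ.2 x hx y hy).2
    rw [Real.dist_eq] at h1
    have h2 : lam * |x - y| ≤ lam * h := by gcongr
    have h3 : lam * h = δ := by rw [hh]; field_simp
    linarith
  have hl0 : 0 ≤ l := hγ.1
  have hph : 0 ≤ p * h := by positivity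
  have hrh : 0 ≤ r * h := by positivity
  have e0 := hclose 0 ⟨le_rfl, hl0⟩ (t - p * h) ⟨by linarith, by linarith [ht.2]⟩
    (by rw [abs_le]; constructor <;> linarith)
  have e1 := hclose l ⟨hl0, le_rfl⟩ (t + r * h) ⟨by linarith [ht.1], by linarith⟩
    (by rw [abs_le]; constructor <;> linarith)
  have i1 := gromovProd_le_add_dist (γ t) (γ 0) (γ (t - p * h)) (γ l)
  have i2 := gromovProd_le_add_dist (γ t) (γ l) (γ (t + r * h)) (γ (t - p * h))
  rw [gromovProd_comm _ (γ l), gromovProd_comm _ (γ (t + r * h))] at i2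
  simp only [← hh, Nat.cast_zero, zero_mul, add_zero, sub_zero, sub_add_cancel,
    Nat.cast_add] at hmain
  rw [show t - p * h + (p + r) * h = t + r * h by ring] at hmain
  set Y := lam ^ 2 * (5 * (c / δ) + 20) with hY
  have hY0 : 0 ≤ Y := by positivity
  have hexp : δ * (48 * Y * (1 - Real.exp (-(((p : ℝ) + r) / Y)))) ≤
      48 * lam ^ 2 * (5 * c + 20 * δ) := by
    calc _ ≤ δ * (48 * Y * 1) := by
          gcongr
          linarith [Real.exp_pos (-(((p : ℝ) + r) / Y))]
      _ = _ := by rw [hY]; field_simp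
  have : 1 * (2 * c + 2 * δ) ≤ lam ^ 2 * (2 * c + 2 * δ) := by gcongr
  linarith

end Sampling

lemma le_A₂ : 980 ≤ A₂ := by
  have h1 : 0 < Real.log 2 := Real.log_pos (by norm_num)
  have h2 : (1 : ℝ) ≤ 1 / Real.log 2 := by
    rw [le_div_iff₀ h1]
    linarith [Real.log_two_lt_d9]
  have h3 := Real.add_one_le_exp (157 * Real.log 2 / 28)
  have h4 : 3 ≤ Real.exp (157 * Real.log 2 / 28) := by linarith [Real.log_two_gt_d9]
  have h5 : 133 * 1 * 3 ≤ 133 * (1 / Real.log 2) * Real.exp (157 * Real.log 2 / 28) := by gcongr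
  rw [mul_one_div] at h5
  unfold A₂
  linarith

end MorseLemma

open MorseLemma in
theorem theorem1 {E : Type*} [MetricSpace E] (hE : MorseLemma.IsGeodesicSpace E)
    (δ : ℝ) (hδ : MorseLemma.IsHyperbolic E δ)
    (lam c l : ℝ) (hlam : 1 ≤ lam)
    (γ : ℝ → E) (hγ : MorseLemma.IsQuasiGeodesic lam c l γ)
    (S : Set E) (hS : MorseLemma.IsGeodesicSegment S (γ 0) (γ l)) :
    ∀ t ∈ Set.Icc (0 : ℝ) l, ∃ s ∈ S,
      dist (γ t) s ≤ lam ^ 2 * (MorseLemma.A₁ * c + MorseLemma.A₂ * δ) := by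
  intro t ht
  have hδ0 : 0 ≤ δ := hδ.nonneg hE (γ t)
  have hc : 0 ≤ c := by simpa using (hγ.2 t ht t ht).2
  have hlam2 : 0 < lam ^ 2 := by positivity
  refine hS.exists_dist_le_of_infDist_le (le_of_forall_pos_le_add fun ε hε => ?_)
  -- the case `δ = 0` is a limit of cases with positive hyperbolicity constant
  set δ' := δ + ε / (980 * lam ^ 2) with hδ'
  have hpos : 0 < ε / (980 * lam ^ 2) := by positivity
  have hhyp : IsHyperbolic E δ' := fun x y z XY XZ YZ h1 h2 h3 p hp =>
    (hδ x y z XY XZ YZ h1 h2 h3 p hp).trans (by linarith)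
  obtain ⟨s, hs, hd⟩ := exists_mem_dist_le_gromovProd hE hhyp (γ t) hS
  have hprod := hγ.gromovProd_le hE hhyp (by linarith) hlam ht
  have h1 : 1 * (2 * δ') ≤ lam ^ 2 * (2 * δ') := by
    gcongr
    exact one_le_pow₀ hlam
  have h2 : lam ^ 2 * (980 * δ') = lam ^ 2 * (980 * δ) + ε := by rw [hδ']; field_simp
  have h3 : lam ^ 2 * (491 / 2 * c + 980 * δ) ≤ lam ^ 2 * (A₁ * c + A₂ * δ) := by
    have := le_A₂
    unfold A₁
    gcongr
    norm_num
  linarith [Metric.infDist_le_dist_of_mem (x := γ t) hs]
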